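/- **Theorem (almost lossless coding, known statistics).** Let $\mathcal X$ be a countably infinite alphabet (with its power set as $\sigma$-algebra) and let $\mu$ be a probability measure on $\mathcal X$ with finite Shannon entropy $$H(\mu)=-\sum_{x\in\mathcal X}\mu(\{x\})\log_2\mu(\{x\})<\infty,\qquad 0\log_2 0:=0 .$$ For $n\ge 1$ let $\mu^n$ be the $n$-fold product measure on $\mathcal X^n$ (the law of a block $X^n$ of the memoryless source driven by $\mu$). A lossy variable-length code of block length $n$ is a pair $(f_n,g_n)$ of maps $f_n:\mathcal X^n\to\{0,1\}^\star$ and $g_n:\{0,1\}^\star\to\mathcal X^n$, where $f_n$ is not required to be injective but is prefix free: no codeword in $f_n(\mathcal X^n)$ is a proper prefix of another one. With $\mathcal L(w)$ the length of the binary string $w$, its rate and its average per-letter Hamming distortion are $$r(f_n,\mu^n)=\frac1n\,\mathbb E_{X^n\sim\mu^n}\big[\mathcal L(f_n(X^n))\big],\qquad d(f_n,g_n,\mu^n)=\mathbb E_{X^n\sim\mu^n}\Big[\frac1n\sum_{i=1}^n\mathbf 1\{X_i\neq (g_n(f_n(X^n)))_i\}\Big].$$ A real number $R>0$ is achievable if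 there is a sequence of such codes $(f_n,g_n)_{n\ge1}$ with $$\limsup_{n\to\infty} r(f_n,\mu^n)\le R\qquad\text{and}\qquad \lim_{n\to\infty}d(f_n,g_n,\mu^n)=0 .$$ Let $R_{al}(\mu)=\inf\{R>0: R\text{ is achievable}\}$ be the minimum achievable rate. Then $$R_{al}(\mu)=H(\mu),$$ and the infimum is attained whenever $H(\mu)>0$, that is, $H(\mu)$ is then itself achievable. -/

import Mathlib

open MeasureTheory Filter Topology
open scoped ENNReal

namespace AlmostLossless

noncomputable section

/-- Shannon entropy in bits, `H(μ) = -∑ₓ μ{x} log₂ μ{x}` with `0 log 0 = 0`, valued in `[0, ∞]`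
(every summand is nonnegative for a probability measure). -/
def entropy {X : Type*} [MeasurableSpace X] (μ : Measure X) : ℝ≥0∞ :=
  ∑' x : X, ENNReal.ofReal (-(μ.real {x} * Real.logb 2 (μ.real {x})))

/-- The law `μⁿ` of a block of `n` letters of the memoryless source driven by `μ`. -/
def blockLaw {X : Type*} [MeasurableSpace X] (μ : Measure X) (n : ℕ) : Measure (Fin n → X) :=
  Measure.pi fun _ => μ

/-- A (possibly lossy, hence possibly non-injective) encoder is prefix free if no codeword it uses
is a proper prefix of another codeword it uses. -/
def IsPrefixFree {A : Type*} (f : A → List Bool) : Prop :=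
  ∀ a b : A, f a <+: f b → f a = f b

/-- Rate, in bits per letter: the expected codeword length divided by the block length. -/
def rate {X : Type*} [MeasurableSpace X] (μ : Measure X) (n : ℕ)
    (f : (Fin n → X) → List Bool) : ℝ≥0∞ :=
  (∫⁻ x, ((f x).length : ℝ≥0∞) ∂(blockLaw μ n)) / n

open Classical in
/-- The per-letter Hamming distortion `(1 / n) ∑ᵢ 1{xᵢ ≠ yᵢ}`. -/
def perLetterDistortion {X : Type*} (n : ℕ) (x y : Fin n → X) : ℝ≥0∞ :=
  (hammingDist x y : ℝ≥0∞) / n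

/-- Average per-letter Hamming distortion between a block and its reconstruction. -/
def distortion {X : Type*} [MeasurableSpace X] (μ : Measure X) (n : ℕ)
    (f : (Fin n → X) → List Bool) (g : List Bool → (Fin n → X)) : ℝ≥0∞ :=
  ∫⁻ x, perLetterDistortion n x (g (f x)) ∂(blockLaw μ n)

/-- The rate `R`, a positive finite number, is achievable for almost lossless coding of the
memoryless source driven by `μ`. -/
def IsAchievable {X : Type*} [MeasurableSpace X] (μ : Measure X) (R : ℝ≥0∞) : Prop :=
  0 < R ∧ R < ∞ ∧
    ∃ (f : ∀ n : ℕ, (Fin n → X) → List Bool) (g : ∀ n : ℕ, List Bool → (Fin n → X)),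
      (∀ n, IsPrefixFree (f n)) ∧
      limsup (fun n => rate μ n (f n)) atTop ≤ R ∧
      Tendsto (fun n => distortion μ n (f n) (g n)) atTop (𝓝 0)

/-- The minimum achievable rate `R_al(μ)`: the infimum of all achievable rates (in `[0, ∞]`, so it
is `∞` if no rate is achievable). -/
def minAchievableRate {X : Type*} [MeasurableSpace X] (μ : Measure X) : ℝ≥0∞ :=
  sInf {R : ℝ≥0∞ | IsAchievable μ R}

end

end AlmostLossless

namespace AlmostLossless

/-! ### Kraft's inequality for prefix-free encoders -/

/-! Allowing vanishing distortion saves nothing. For the upper bound, a Shannon-Fano-Elias code on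
blocks is lossless off a null set and spends at most two bits beyond the self-information of the
block, i.e. `2 / n` per letter (`exists_lossless_codes`).

For the converse, attach to each codeword `w` the product law `Q_w` obtained by redrawing each
letter of `g w` from `μ` with probability `δ`. By Kraft, `∑ 2^(-|w|) Q_w` has mass at most one, so
on average describing `x` by `f x` and then by an ideal code for `Q_(f x)` costs at least the
entropy of the block. The second description costs `-log (1 - δ)` per correct letter and `-log δ -
log μ{x_i}` per wrong one. Cutting the self-information at `M` bounds the cost of wrong letters by a
multiple of the distortion plus a tail (`entropy_le_rate_add`). Letting `n → ∞`, then `δ → 0` and `M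
→ ∞`, removes every excess term. -/

theorem uniquelyDecodable_of_prefixFree {α : Type*} {S : Set (List α)}
    (hS : ∀ v ∈ S, ∀ w ∈ S, v <+: w → v = w) (h0 : [] ∉ S) :
    InformationTheory.UniquelyDecodable S := by
  intro L₁
  induction L₁ with
  | nil =>
    intro L₂ _ h₂ h
    cases L₂ with
    | nil => rfl
    | cons b M =>
      have : b = [] := (List.append_eq_nil_iff.1 h.symm).1
      exact absurd (this ▸ h₂ b (by simp)) h0
  | cons a L ih =>
    intro L₂ h₁ h₂ h
    cases L₂ with
    | nil =>
      have : a = [] := (List.append_eq_nil_iff.1 h).1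
      exact absurd (this ▸ h₁ a (by simp)) h0
    | cons b M =>
      rw [List.flatten_cons, List.flatten_cons] at h
      have hab : a = b := by
        rcases List.prefix_or_prefix_of_prefix (List.prefix_append a L.flatten)
          (h ▸ List.prefix_append b M.flatten) with hp | hp
        · exact hS a (h₁ a (by simp)) b (h₂ b (by simp)) hp
        · exact (hS b (h₂ b (by simp)) a (h₁ a (by simp)) hp).symm
      subst hab
      rw [ih M (fun w hw => h₁ w (by simp [hw])) (fun w hw => h₂ w (by simp [hw]))
        (List.append_cancel_left h)]

/-- The sum runs over codewords, not blocks, since many blocks may share one. McMillan's inequality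
applies unless the empty word is used, and then it is the only codeword. -/
theorem IsPrefixFree.kraft {A : Type*} {f : A → List Bool} (hf : IsPrefixFree f) :
    ∑' w : Set.range f, (2⁻¹ : ℝ≥0∞) ^ w.1.length ≤ 1 := by
  have hS : ∀ v ∈ Set.range f, ∀ w ∈ Set.range f, v <+: w → v = w := by
    rintro _ ⟨a, rfl⟩ _ ⟨b, rfl⟩ h
    exact hf a b h
  rw [ENNReal.tsum_eq_iSup_sum]
  refine iSup_le fun s => ?_
  by_cases h0 : [] ∈ Set.range f
  · have hsub : ∀ w : Set.range f, w = ⟨[], h0⟩ := fun w =>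
      Subtype.ext (hS [] h0 w.1 w.2 List.nil_prefix).symm
    calc ∑ w ∈ s, (2⁻¹ : ℝ≥0∞) ^ w.1.length
        ≤ ∑ w ∈ {⟨[], h0⟩}, (2⁻¹ : ℝ≥0∞) ^ (w : Set.range f).1.length :=
          Finset.sum_le_sum_of_subset fun w _ => by simp [hsub w]
      _ = 1 := by simp
  · have hU : InformationTheory.UniquelyDecodable
        ((s.map (Function.Embedding.subtype _) : Finset (List Bool)) : Set (List Bool)) := by
      refine uniquelyDecodable_of_prefixFree (fun v hv w hw => hS v ?_ w ?_) fun h => h0 ?_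
      · obtain ⟨c, -, rfl⟩ := Finset.mem_map.1 hv
        exact c.2
      · obtain ⟨c, -, rfl⟩ := Finset.mem_map.1 hw
        exact c.2
      · obtain ⟨c, -, hc⟩ := Finset.mem_map.1 h
        exact hc ▸ c.2
    have hK := InformationTheory.kraft_mcmillan_inequality hU
    rw [Finset.sum_map] at hK
    have h2 : (2⁻¹ : ℝ≥0∞) = ENNReal.ofReal (1 / 2) := by
      rw [one_div, ENNReal.ofReal_inv_of_pos two_pos]; simp
    calc ∑ w ∈ s, (2⁻¹ : ℝ≥0∞) ^ w.1.length
        = ENNReal.ofReal (∑ w ∈ s, (1 / 2 : ℝ) ^ w.1.length) := by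
          rw [ENNReal.ofReal_sum_of_nonneg (fun _ _ => by positivity)]
          simp_rw [h2, ENNReal.ofReal_pow (by norm_num : (0 : ℝ) ≤ 1 / 2)]
      _ ≤ 1 := ENNReal.ofReal_le_one.2 (by simpa using hK)

/-! ### The Shannon-Fano-Elias code -/

/-- The `l` least significant binary digits of `k`, most significant first. -/
def binaryWord : ℕ → ℕ → List Bool
  | 0, _ => []
  | l + 1, k => binaryWord l (k / 2) ++ [k.bodd]

theorem length_binaryWord (l k : ℕ) : (binaryWord l k).length = l := by
  induction l generalizing k with
  | zero => rfl
  | succ l ih => simp [binaryWord, ih]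

theorem binaryWord_injective {l k j : ℕ} (hk : k < 2 ^ l) (hj : j < 2 ^ l)
    (h : binaryWord l k = binaryWord l j) : k = j := by
  induction l generalizing k j with
  | zero => simp at hk hj; omega
  | succ l ih =>
    obtain ⟨h1, h2⟩ := List.append_inj' h rfl
    have h3 := ih (k := k / 2) (j := j / 2) (by rw [pow_succ] at hk; omega)
      (by rw [pow_succ] at hj; omega) h1
    have h4 : k.bodd = j.bodd := by simpa using h2
    rw [← Nat.bodd_add_div2 k, ← Nat.bodd_add_div2 j, Nat.div2_val, Nat.div2_val, h3, h4]

/-- A word is a prefix of another one only if the dyadic intervals they describe are nested. -/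
theorem binaryWord_prefix {l m k j : ℕ} (hk : k < 2 ^ l) (hj : j < 2 ^ m)
    (h : binaryWord l k <+: binaryWord m j) :
    ∃ d, m = l + d ∧ k * 2 ^ d ≤ j ∧ j < (k + 1) * 2 ^ d := by
  induction m generalizing j with
  | zero =>
    have := h.length_le
    simp only [length_binaryWord] at this
    obtain rfl : l = 0 := by omega
    exact ⟨0, rfl, by simp at *; omega⟩
  | succ m ih =>
    rcases List.prefix_concat_iff.1 h with h | h
    · have hl : l = m + 1 := by
        have := congrArg List.length h
        simpa [length_binaryWord] using this
      subst hl
      obtain rfl := binaryWord_injective hk hj h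
      exact ⟨0, rfl, by simp⟩
    · obtain ⟨d, hd, h1, h2⟩ := ih (by rw [pow_succ] at hj; omega) h
      refine ⟨d + 1, by omega, ?_, ?_⟩ <;> rw [pow_succ, ← mul_assoc] <;> omega

/-- Every probability measure on a countable alphabet has a prefix-free code that is lossless on
the support, with codewords at most two bits longer than the self-information. -/
theorem exists_prefixFree_code {A : Type*} [Countable A] [MeasurableSpace A]
    [DiscreteMeasurableSpace A] (P : Measure A) [IsProbabilityMeasure P] :
    ∃ (f : A → List Bool) (g : List Bool → A), IsPrefixFree f ∧
      ∀ a, P {a} ≠ 0 → g (f a) = a ∧ ((f a).length : ℝ) ≤ -Real.logb 2 (P.real {a}) + 2 := by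
  classical
  have := Encodable.ofCountable A
  obtain ⟨a₀, ha₀⟩ : ∃ a, P {a} ≠ 0 := by
    by_contra! h
    have : P Set.univ = 0 := by
      rw [← Set.biUnion_of_singleton Set.univ]
      exact (measure_biUnion_null_iff Set.countable_univ).2 fun a _ => h a
    simp at this
  have : Nonempty A := ⟨a₀⟩
  set p : A → ℝ := fun a => P.real {a} with hp
  set F : A → ℝ := fun a => P.real {b | Encodable.encode b < Encodable.encode a} with hF
  -- The extra bit gives `2 ^ (-l) ≤ p / 2`, leaving room for a dyadic interval after `F` is rounded
  -- up.
  set l : A → ℕ := fun a => ⌈-Real.logb 2 (p a)⌉₊ + 1 with hl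
  set k : A → ℕ := fun a => ⌈F a * 2 ^ l a⌉₊ with hkdef
  have hppos : ∀ a, P {a} ≠ 0 → 0 < p a := fun a ha =>
    ENNReal.toReal_pos ha (measure_ne_top _ _)
  have hF0 : ∀ a, 0 ≤ F a := fun a => measureReal_nonneg
  have hFp : ∀ a, F a + p a = P.real {b | Encodable.encode b ≤ Encodable.encode a} := by
    intro a
    rw [hF, hp, ← measureReal_union (by simp) (MeasurableSet.of_discrete)]
    congr 1
    ext b
    simp [le_iff_lt_or_eq, or_comm]
  have hF1 : ∀ a, F a + p a ≤ 1 := fun a => hFp a ▸ measureReal_le_one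
  have hFlt : ∀ a b, Encodable.encode a < Encodable.encode b → F a + p a ≤ F b := by
    intro a b hab
    rw [hFp]
    exact measureReal_mono fun c (hc : _ ≤ _) => lt_of_le_of_lt hc hab
  have hlen : ∀ a, P {a} ≠ 0 → 2 ≤ p a * 2 ^ l a := by
    intro a ha
    have h1 : -Real.logb 2 (p a) ≤ (⌈-Real.logb 2 (p a)⌉₊ : ℝ) := Nat.le_ceil _
    have h2 : (p a)⁻¹ ≤ (2 : ℝ) ^ ⌈-Real.logb 2 (p a)⌉₊ := by
      rw [← Real.logb_inv, Real.logb_le_iff_le_rpow one_lt_two (inv_pos.2 (hppos a ha)),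
        Real.rpow_natCast] at h1
      rwa [← Real.logb_inv]
    have h3 := mul_le_mul_of_nonneg_left h2 (hppos a ha).le
    rw [mul_inv_cancel₀ (hppos a ha).ne'] at h3
    simp only [hl, pow_succ]
    linarith
  -- the dyadic interval `[k / 2 ^ l, (k + 1) / 2 ^ l)` lies in `[F, F + p)`
  have hk1 : ∀ a, F a * 2 ^ l a ≤ k a := fun a => Nat.le_ceil _
  have hk2 : ∀ a, P {a} ≠ 0 → (k a : ℝ) + 1 < (F a + p a) * 2 ^ l a := by
    intro a ha
    have h1 : (k a : ℝ) < F a * 2 ^ l a + 1 :=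
      Nat.ceil_lt_add_one (mul_nonneg (hF0 a) (by positivity))
    linarith [hlen a ha]
  have hk3 : ∀ a, P {a} ≠ 0 → k a < 2 ^ l a := by
    intro a ha
    have h1 : (F a + p a) * 2 ^ l a ≤ 1 * 2 ^ l a :=
      mul_le_mul_of_nonneg_right (hF1 a) (by positivity)
    have h2 : (k a : ℝ) < 2 ^ l a := by linarith [hk2 a ha]
    exact_mod_cast h2
  have hpre : ∀ a b, P {a} ≠ 0 → P {b} ≠ 0 →
      binaryWord (l a) (k a) <+: binaryWord (l b) (k b) → a = b := by
    intro a b ha hb h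
    obtain ⟨d, hd, h1, h2⟩ := binaryWord_prefix (hk3 a ha) (hk3 b hb) h
    have h1' : (k a : ℝ) * 2 ^ d ≤ k b := by exact_mod_cast h1
    have h2' : (k b : ℝ) + 1 ≤ (k a + 1) * 2 ^ d := by exact_mod_cast h2
    have hpow : (2 : ℝ) ^ l b = 2 ^ l a * 2 ^ d := by rw [hd, pow_add]
    have hd0 : (0 : ℝ) < 2 ^ d := by positivity
    have hb0 : (0 : ℝ) < 2 ^ l b := by positivity
    have e1 : F a * 2 ^ l b < (F b + p b) * 2 ^ l b := by
      have := mul_le_mul_of_nonneg_right (hk1 a) hd0.le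
      rw [mul_assoc, ← hpow] at this
      linarith [hk2 b hb]
    have e2 : F b * 2 ^ l b < (F a + p a) * 2 ^ l b := by
      have := mul_lt_mul_of_pos_right (hk2 a ha) hd0
      rw [mul_assoc, ← hpow] at this
      linarith [hk1 b]
    have e1 := lt_of_mul_lt_mul_right e1 hb0.le
    have e2 := lt_of_mul_lt_mul_right e2 hb0.le
    rcases lt_trichotomy (Encodable.encode a) (Encodable.encode b) with hab | hab | hab
    · linarith [hFlt a b hab]
    · exact Encodable.encode_injective hab
    · linarith [hFlt b a hab]
  -- Null letters own no interval, so they borrow the codeword of `a₀`; applying `s` after inversion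
  -- undoes this in the decoder.
  set s : A → A := fun a => if P {a} ≠ 0 then a else a₀ with hs
  have hsP : ∀ a, P {s a} ≠ 0 := by
    intro a
    by_cases h : P {a} = 0 <;> simp [hs, h, ha₀]
  set f : A → List Bool := fun a => binaryWord (l (s a)) (k (s a)) with hf
  have hfs : ∀ a b, f a <+: f b → s a = s b := fun a b h => hpre _ _ (hsP a) (hsP b) h
  refine ⟨f, fun w => s (Function.invFun f w), fun a b h => by simp only [hf, hfs a b h], ?_⟩
  intro a ha
  have hsa : s a = a := if_pos ha
  refine ⟨?_, ?_⟩
  · have : f (Function.invFun f (f a)) = f a := Function.invFun_eq ⟨a, rfl⟩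
    exact (hfs _ _ ⟨[], by simp [this]⟩).trans hsa
  · simp only [hf, length_binaryWord, hsa, hl]
    have h0 : 0 ≤ -Real.logb 2 (p a) := by
      have := Real.logb_nonpos one_lt_two (hppos a ha).le measureReal_le_one
      linarith
    push_cast
    linarith [Nat.ceil_lt_add_one h0]

end AlmostLossless

/-! ### Self-information and block laws -/

namespace AlmostLossless

variable {X : Type*} [MeasurableSpace X]

/-- The self-information of a letter, in bits. -/
noncomputable def selfInformation (μ : Measure X) (x : X) : ℝ≥0∞ :=
  ENNReal.ofReal (-Real.logb 2 (μ.real {x}))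

instance (μ : Measure X) [IsProbabilityMeasure μ] (n : ℕ) :
    IsProbabilityMeasure (blockLaw μ n) := by
  unfold blockLaw; infer_instance

theorem blockLaw_singleton (μ : Measure X) [IsProbabilityMeasure μ] {n : ℕ} (x : Fin n → X) :
    blockLaw μ n {x} = ∏ i, μ {x i} := Measure.pi_singleton _ x

theorem lintegral_blockLaw_eval (μ : Measure X) [IsProbabilityMeasure μ] {n : ℕ} (i : Fin n)
    {φ : X → ℝ≥0∞} (hφ : Measurable φ) :
    ∫⁻ x, φ (x i) ∂(blockLaw μ n) = ∫⁻ a, φ a ∂μ :=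
  (measurePreserving_eval (fun _ : Fin n => μ) i).lintegral_comp hφ

theorem lintegral_blockLaw_sum (μ : Measure X) [IsProbabilityMeasure μ] (n : ℕ)
    {φ : X → ℝ≥0∞} (hφ : Measurable φ) :
    ∫⁻ x, ∑ i, φ (x i) ∂(blockLaw μ n) = n * ∫⁻ a, φ a ∂μ := by
  rw [lintegral_finsetSum _ fun i _ => by fun_prop]
  simp [lintegral_blockLaw_eval μ _ hφ]

variable [Countable X] [DiscreteMeasurableSpace X]

theorem lintegral_selfInformation (μ : Measure X) [IsProbabilityMeasure μ] :
    ∫⁻ x, selfInformation μ x ∂μ = entropy μ := by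
  rw [lintegral_countable' _, entropy]
  refine tsum_congr fun x => ?_
  rw [selfInformation, ← ofReal_measureReal (μ := μ) (s := {x}), mul_comm,
    ← ENNReal.ofReal_mul measureReal_nonneg, mul_neg]

theorem tsum_measure_singleton {A : Type*} [Countable A] [MeasurableSpace A]
    [DiscreteMeasurableSpace A] (Q : Measure A) : ∑' a, Q {a} = Q Set.univ := by
  simpa using (lintegral_countable' (μ := Q) fun _ => 1).symm

theorem ae_singleton_ne_zero {A : Type*} [Countable A] (hA : MeasurableSpace A) (P : Measure A) :
    ∀ᵐ a ∂P, P {a} ≠ 0 := by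
  rw [ae_iff_of_countable]
  exact fun _ h => h

/-! ### Achievability -/

theorem exists_lossless_codes (μ : Measure X) [IsProbabilityMeasure μ] :
    ∃ (f : ∀ n : ℕ, (Fin n → X) → List Bool) (g : ∀ n : ℕ, List Bool → (Fin n → X)),
      (∀ n, IsPrefixFree (f n)) ∧
      limsup (fun n => rate μ n (f n)) atTop ≤ entropy μ ∧
      Tendsto (fun n => distortion μ n (f n) (g n)) atTop (𝓝 0) := by
  choose f g hf hfg using fun n => exists_prefixFree_code (blockLaw μ n)
  refine ⟨f, g, hf, ?_, ?_⟩
  · have hrate : ∀ n : ℕ, 0 < n → rate μ n (f n) ≤ entropy μ + 2 / n := by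
      intro n hn
      have hn0 : (n : ℝ≥0∞) ≠ 0 := by exact_mod_cast hn.ne'
      have hpt : ∀ᵐ x ∂(blockLaw μ n),
          ((f n x).length : ℝ≥0∞) ≤ ∑ i, selfInformation μ (x i) + 2 := by
        filter_upwards [ae_singleton_ne_zero _ (blockLaw μ n)] with x hx
        have hx' : ∀ i, μ.real {x i} ≠ 0 := by
          rw [blockLaw_singleton, Finset.prod_ne_zero_iff] at hx
          exact fun i => (ENNReal.toReal_pos (hx i (Finset.mem_univ _)) (measure_ne_top _ _)).ne'
        have hlog : -Real.logb 2 ((blockLaw μ n).real {x})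
            = ∑ i, -Real.logb 2 (μ.real {x i}) := by
          rw [Measure.real, blockLaw_singleton, ENNReal.toReal_prod, Finset.sum_neg_distrib]
          congr 1
          exact Real.logb_prod _ _ fun i _ => hx' i
        have h0 : ∀ i, 0 ≤ -Real.logb 2 (μ.real {x i}) := fun i => by
          have := Real.logb_nonpos one_lt_two (measureReal_nonneg (μ := μ) (s := {x i}))
            measureReal_le_one
          linarith
        have := ENNReal.ofReal_le_ofReal ((hfg n x hx).2)
        rw [hlog, ENNReal.ofReal_add (Finset.sum_nonneg fun i _ => h0 i) zero_le_two,
          ENNReal.ofReal_sum_of_nonneg fun i _ => h0 i] at this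
        simpa [selfInformation] using this
      calc rate μ n (f n) ≤ (n * entropy μ + 2) / n := by
            refine ENNReal.div_le_div_right ((lintegral_mono_ae hpt).trans_eq ?_) _
            rw [lintegral_add_right _ measurable_const,
              lintegral_blockLaw_sum μ n .of_discrete, lintegral_selfInformation]
            simp
        _ = entropy μ + 2 / n := by
            rw [ENNReal.add_div, ENNReal.mul_div_right_comm,
              ENNReal.div_self hn0 (ENNReal.natCast_ne_top n), one_mul]
    have hlim : Tendsto (fun n : ℕ => entropy μ + 2 / (n : ℝ≥0∞)) atTop (𝓝 (entropy μ)) := by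
      have h : Tendsto (fun n : ℕ => 2 / (n : ℝ≥0∞)) atTop (𝓝 0) := by
        have := ENNReal.Tendsto.const_mul (a := 2) ENNReal.tendsto_inv_nat_nhds_zero
          (Or.inr ENNReal.ofNat_ne_top)
        simpa [div_eq_mul_inv] using this
      simpa using h.const_add (entropy μ)
    rw [← hlim.limsup_eq]
    exact limsup_le_limsup ((eventually_gt_atTop 0).mono hrate)
  · have : ∀ n, distortion μ n (f n) (g n) = 0 := by
      intro n
      refine (lintegral_congr_ae ?_).trans lintegral_zero
      filter_upwards [ae_singleton_ne_zero _ (blockLaw μ n)] with x hx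
      simp [(hfg n x hx).1, perLetterDistortion]
    simp [this]

/-! ### Converse -/

/-- This is `log t ≤ t - 1` at `t = 2^(-l) ∏ v i / p i`, in bits. The constant stays on the left so
that no subtraction is needed in `ℝ≥0∞`. -/
theorem logb_sum_le {ι : Type*} [Fintype ι] {p v : ι → ℝ} (hp : ∀ i, 0 < p i)
    (hv : ∀ i, 0 < v i) (l : ℕ) :
    ∑ i, -Real.logb 2 (p i) + 1 / Real.log 2 ≤
      l + ∑ i, -Real.logb 2 (v i) + 2⁻¹ ^ l * (∏ i, v i / p i) * (1 / Real.log 2) := by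
  have h2 : 0 < Real.log 2 := Real.log_pos one_lt_two
  have hr : ∀ i, 0 < v i / p i := fun i => div_pos (hv i) (hp i)
  have hprod : 0 < ∏ i, v i / p i := Finset.prod_pos fun i _ => hr i
  have ht := Real.log_le_sub_one_of_pos
    (mul_pos (pow_pos (by norm_num : (0 : ℝ) < 2⁻¹) l) hprod)
  rw [Real.log_mul (by positivity) hprod.ne', Real.log_pow,
    Real.log_inv, Real.log_prod fun i _ => (hr i).ne'] at ht
  simp_rw [Real.log_div (hv _).ne' (hp _).ne'] at ht
  rw [Finset.sum_sub_distrib] at ht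
  simp only [Real.logb, Finset.sum_neg_distrib, ← Finset.sum_div]
  rw [← sub_nonneg]
  have : 0 ≤ (2⁻¹ ^ l * (∏ i, v i / p i) - 1 -
    (l * -Real.log 2 + (∑ i, Real.log (v i) - ∑ i, Real.log (p i)))) / Real.log 2 :=
    div_nonneg (by linarith) h2.le
  refine this.trans_eq ?_
  field_simp
  ring

end AlmostLossless

/-! ### Converse through randomly perturbed reconstructions -/

namespace AlmostLossless

variable {X : Type*} [MeasurableSpace X]

/-- The law `(1 - δ) δ_b + δ μ` of the letter `b`, redrawn from `μ` with probability `δ`. -/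
noncomputable def noisyLetter (μ : Measure X) (δ : ℝ) (b : X) : Measure X :=
  ENNReal.ofReal (1 - δ) • Measure.dirac b + ENNReal.ofReal δ • μ

theorem isProbabilityMeasure_noisyLetter (μ : Measure X) [IsProbabilityMeasure μ] {δ : ℝ}
    (h0 : 0 < δ) (h1 : δ < 1) (b : X) : IsProbabilityMeasure (noisyLetter μ δ b) := by
  constructor
  simp only [noisyLetter, Measure.coe_add, Measure.coe_smul, Pi.add_apply, Pi.smul_apply,
    measure_univ, smul_eq_mul, mul_one]
  rw [← ENNReal.ofReal_add (by linarith) h0.le]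
  simp

theorem noisyLetter_singleton_self (μ : Measure X) (δ : ℝ) (b : X) :
    ENNReal.ofReal (1 - δ) ≤ noisyLetter μ δ b {b} := by
  simp [noisyLetter]

theorem noisyLetter_singleton (μ : Measure X) (δ : ℝ) (a b : X) :
    ENNReal.ofReal δ * μ {a} ≤ noisyLetter μ δ b {a} := by
  simp [noisyLetter]

/-- The part of the self-information that exceeds `M`. -/
noncomputable def largeInformation (μ : Measure X) (M : ℕ) : X → ℝ≥0∞ :=
  {x | (M : ℝ≥0∞) < selfInformation μ x}.indicator (selfInformation μ)

theorem selfInformation_le (μ : Measure X) (M : ℕ) (x : X) :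
    selfInformation μ x ≤ M + largeInformation μ M x := by
  by_cases h : (M : ℝ≥0∞) < selfInformation μ x
  · simp [largeInformation, h]
  · exact (not_lt.1 h).trans le_self_add

-- Redrawing from `μ` itself makes a wrong letter cost only `-log δ` beyond its own
-- self-information. The latter is unbounded in general, hence the truncation at `M`.
open Classical in
theorem noisyLetter_information_le (μ : Measure X) [IsProbabilityMeasure μ] {δ : ℝ}
    (h0 : 0 < δ) (h1 : δ < 1) (M : ℕ) {a b : X} (ha : μ {a} ≠ 0) :
    selfInformation (noisyLetter μ δ b) a ≤
      ENNReal.ofReal (-Real.logb 2 (1 - δ)) +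
        (ENNReal.ofReal (-Real.logb 2 δ) + M) * (if a ≠ b then 1 else 0) +
        largeInformation μ M a := by
  have := isProbabilityMeasure_noisyLetter μ h0 h1 b
  have ha' : 0 < μ.real {a} := ENNReal.toReal_pos ha (measure_ne_top _ _)
  by_cases hab : a = b
  · subst hab
    refine le_trans (ENNReal.ofReal_le_ofReal ?_) (le_add_right le_self_add)
    have h := ENNReal.toReal_mono (measure_ne_top _ _) (noisyLetter_singleton_self μ δ a)
    rw [ENNReal.toReal_ofReal (by linarith)] at h
    exact neg_le_neg (Real.logb_le_logb_of_le one_lt_two (by linarith) h)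
  · have h := ENNReal.toReal_mono (measure_ne_top _ _) (noisyLetter_singleton μ δ a b)
    rw [ENNReal.toReal_mul, ENNReal.toReal_ofReal h0.le] at h
    have h' := Real.logb_le_logb_of_le one_lt_two (mul_pos h0 ha') h
    rw [Real.logb_mul h0.ne' ha'.ne'] at h'
    calc selfInformation (noisyLetter μ δ b) a
        ≤ ENNReal.ofReal (-Real.logb 2 δ + -Real.logb 2 (μ.real {a})) :=
          ENNReal.ofReal_le_ofReal (by unfold Measure.real at *; linarith)
      _ ≤ ENNReal.ofReal (-Real.logb 2 δ) + selfInformation μ a := ENNReal.ofReal_add_le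
      _ ≤ ENNReal.ofReal (-Real.logb 2 δ) + (M + largeInformation μ M a) := by
          gcongr; exact selfInformation_le μ M a
      _ ≤ _ := by
          simp only [ne_eq, hab, not_false_eq_true, if_true, mul_one]
          rw [← add_assoc]
          exact add_le_add le_add_self le_rfl

theorem sum_selfInformation_le (μ : Measure X) [IsProbabilityMeasure μ] {δ : ℝ}
    (h0 : 0 < δ) (h1 : δ < 1) {n : ℕ} {x : Fin n → X} (y : Fin n → X)
    (hx : ∀ i, μ {x i} ≠ 0) (l : ℕ) :
    ∑ i, selfInformation μ (x i) + ENNReal.ofReal (1 / Real.log 2) ≤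
      l + ∑ i, selfInformation (noisyLetter μ δ (y i)) (x i) +
        2⁻¹ ^ l * (∏ i, noisyLetter μ δ (y i) {x i} / μ {x i}) *
          ENNReal.ofReal (1 / Real.log 2) := by
  have hpr := isProbabilityMeasure_noisyLetter μ h0 h1
  have hp : ∀ i, 0 < μ.real {x i} := fun i => ENNReal.toReal_pos (hx i) (measure_ne_top _ _)
  have hv : ∀ i, 0 < (noisyLetter μ δ (y i)).real {x i} := fun i => by
    refine ENNReal.toReal_pos (fun h => ?_) (measure_ne_top _ _)
    have := (noisyLetter_singleton μ δ (x i) (y i)).trans_eq h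
    simp [hx i] at this
    linarith
  have hneg : ∀ (ν : Measure X) [IsProbabilityMeasure ν] (a : X),
      0 ≤ -Real.logb 2 (ν.real {a}) := fun ν _ a => by
    have := Real.logb_nonpos one_lt_two (measureReal_nonneg (μ := ν) (s := {a}))
      measureReal_le_one
    linarith
  have h2 : 0 ≤ 1 / Real.log 2 := by positivity
  have h := ENNReal.ofReal_le_ofReal (logb_sum_le hp hv l)
  have hprod : 0 ≤ ∏ i, (noisyLetter μ δ (y i)).real {x i} / μ.real {x i} :=
    Finset.prod_nonneg fun i _ => by positivity
  rw [ENNReal.ofReal_add (Finset.sum_nonneg fun i _ => hneg _ _) h2,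
    ENNReal.ofReal_add (add_nonneg l.cast_nonneg (Finset.sum_nonneg fun i _ => hneg _ _))
      (by positivity),
    ENNReal.ofReal_add l.cast_nonneg (Finset.sum_nonneg fun i _ => hneg _ _),
    ENNReal.ofReal_mul (by positivity), ENNReal.ofReal_mul (by positivity),
    ENNReal.ofReal_sum_of_nonneg fun i _ => hneg _ _,
    ENNReal.ofReal_sum_of_nonneg fun i _ => hneg _ _,
    ENNReal.ofReal_prod_of_nonneg fun i _ => by positivity,
    ENNReal.ofReal_pow (by positivity), ENNReal.ofReal_inv_of_pos two_pos] at h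
  have hdiv : ∀ i, ENNReal.ofReal ((noisyLetter μ δ (y i)).real {x i} / μ.real {x i}) =
      noisyLetter μ δ (y i) {x i} / μ {x i} := fun i => by
    rw [ENNReal.ofReal_div_of_pos (hp i), ofReal_measureReal, ofReal_measureReal]
  simp_rw [hdiv] at h
  simpa [selfInformation] using h

variable [Countable X] [DiscreteMeasurableSpace X]

/-- Dominated convergence: finite entropy makes the self-information an integrable bound. -/
theorem tendsto_lintegral_largeInformation (μ : Measure X) [IsProbabilityMeasure μ]
    (hμ : entropy μ < ∞) :
    Tendsto (fun M : ℕ => ∫⁻ x, largeInformation μ M x ∂μ) atTop (𝓝 0) := by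
  rw [← lintegral_zero (μ := μ)]
  refine tendsto_lintegral_of_dominated_convergence (selfInformation μ)
    (fun M => .of_discrete) (fun M => ?_) ?_ ?_
  · exact ae_of_all _ fun x => Set.indicator_le_self _ _ x
  · rw [lintegral_selfInformation]; exact hμ.ne
  · refine ae_of_all _ fun x => tendsto_const_nhds.congr' ?_
    obtain ⟨m, hm⟩ := ENNReal.exists_nat_gt (r := selfInformation μ x) ENNReal.ofReal_ne_top
    filter_upwards [eventually_ge_atTop m] with M hM
    have : ¬ (M : ℝ≥0∞) < selfInformation μ x :=
      not_lt.2 (hm.le.trans (by exact_mod_cast hM))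
    simp [largeInformation, this]

/-- Integrating against `μⁿ` cancels the denominators. Enlarging the single term `f x` to all
codewords leaves probability measures `Q w` weighted by Kraft's sum. -/
theorem lintegral_likelihood_le (μ : Measure X) [IsProbabilityMeasure μ] {δ : ℝ}
    (h0 : 0 < δ) (h1 : δ < 1) {n : ℕ} {f : (Fin n → X) → List Bool} (hf : IsPrefixFree f)
    (g : List Bool → (Fin n → X)) :
    ∫⁻ x, 2⁻¹ ^ (f x).length * (∏ i, noisyLetter μ δ (g (f x) i) {x i} / μ {x i})
      ∂(blockLaw μ n) ≤ 1 := by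
  have hpr := isProbabilityMeasure_noisyLetter μ h0 h1
  let Q : List Bool → Measure (Fin n → X) := fun w => Measure.pi fun i => noisyLetter μ δ (g w i)
  rw [lintegral_countable' _]
  calc _ ≤ ∑' x, 2⁻¹ ^ (f x).length * Q (f x) {x} := by
        refine ENNReal.tsum_le_tsum fun x => ?_
        rw [mul_assoc, blockLaw_singleton, ← Finset.prod_mul_distrib]
        simp only [Q, Measure.pi_singleton]
        gcongr with i
        -- Only an inequality: if `μ {x i} = 0` the product is zero.
        exact ENNReal.mul_le_of_le_div le_rfl
    _ ≤ ∑' x, ∑' w : Set.range f, 2⁻¹ ^ w.1.length * Q w {x} :=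
        ENNReal.tsum_le_tsum fun x =>
          ENNReal.le_tsum (f := fun w : Set.range f => 2⁻¹ ^ w.1.length * Q w {x}) ⟨f x, x, rfl⟩
    _ = ∑' w : Set.range f, 2⁻¹ ^ w.1.length := by
        rw [ENNReal.tsum_comm]
        simp_rw [ENNReal.tsum_mul_left, tsum_measure_singleton]
        simp [Q]
    _ ≤ 1 := hf.kraft

/-- The nonasymptotic converse. -/
theorem entropy_le_rate_add (μ : Measure X) [IsProbabilityMeasure μ] {δ : ℝ}
    (h0 : 0 < δ) (h1 : δ < 1) (M : ℕ) {n : ℕ} (hn : 0 < n) {f : (Fin n → X) → List Bool}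
    (hf : IsPrefixFree f) (g : List Bool → (Fin n → X)) :
    entropy μ ≤ rate μ n f + (ENNReal.ofReal (-Real.logb 2 δ) + M) * distortion μ n f g +
      (ENNReal.ofReal (-Real.logb 2 (1 - δ)) + ∫⁻ x, largeInformation μ M x ∂μ) := by
  classical
  set c₁ := ENNReal.ofReal (-Real.logb 2 (1 - δ))
  set c₂ := ENNReal.ofReal (-Real.logb 2 δ) + M
  set C := ENNReal.ofReal (1 / Real.log 2)
  have hn0 : (n : ℝ≥0∞) ≠ 0 := by exact_mod_cast hn.ne'
  have hnt : (n : ℝ≥0∞) ≠ ∞ := ENNReal.natCast_ne_top n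
  set t : (Fin n → X) → ℝ≥0∞ := fun x =>
    2⁻¹ ^ (f x).length * (∏ i, noisyLetter μ δ (g (f x) i) {x i} / μ {x i})
  have hpt : ∀ᵐ x ∂(blockLaw μ n),
      ∑ i, selfInformation μ (x i) + C ≤
        (f x).length + n * c₂ * perLetterDistortion n x (g (f x)) + n * c₁ +
          ∑ i, largeInformation μ M (x i) + t x * C := by
    filter_upwards [ae_singleton_ne_zero _ (blockLaw μ n)] with x hx
    rw [blockLaw_singleton, Finset.prod_ne_zero_iff] at hx
    refine (sum_selfInformation_le μ h0 h1 (g (f x)) (fun i => hx i (Finset.mem_univ _))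
      (f x).length).trans ?_
    gcongr ?_ + _
    have hsum : ∑ i, selfInformation (noisyLetter μ δ (g (f x) i)) (x i) ≤
        n * c₁ + c₂ * hammingDist x (g (f x)) + ∑ i, largeInformation μ M (x i) := by
      refine (Finset.sum_le_sum fun i _ =>
        noisyLetter_information_le μ h0 h1 M (hx i (Finset.mem_univ _))).trans_eq ?_
      rw [Finset.sum_add_distrib, Finset.sum_add_distrib, ← Finset.mul_sum, Finset.sum_boole]
      simp only [Finset.sum_const, Finset.card_univ, Fintype.card_fin, nsmul_eq_mul, hammingDist]
      congr!
    have hd : n * c₂ * perLetterDistortion n x (g (f x)) = c₂ * hammingDist x (g (f x)) := by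
      rw [perLetterDistortion, mul_comm (n : ℝ≥0∞), mul_assoc, ENNReal.mul_div_cancel hn0 hnt]
    rw [hd]
    refine (add_le_add_right hsum _).trans_eq ?_
    ring
  have hint := lintegral_mono_ae hpt
  have hm (φ : (Fin n → X) → ℝ≥0∞) : Measurable φ := .of_discrete
  rw [lintegral_add_right _ (hm _), lintegral_add_right _ (hm _), lintegral_add_right _ (hm _),
    lintegral_add_right _ (hm _), lintegral_add_right _ (hm _), lintegral_const_mul _ (hm _),
    lintegral_const, lintegral_const, measure_univ,
    lintegral_blockLaw_sum μ n .of_discrete, lintegral_blockLaw_sum μ n .of_discrete,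
    lintegral_selfInformation, mul_one, mul_one] at hint
  have hlt : ∫⁻ x, t x * C ∂(blockLaw μ n) ≤ C := by
    rw [lintegral_mul_const _ (hm _)]
    exact mul_le_of_le_one_left' (lintegral_likelihood_le μ h0 h1 hf g)
  -- The mean likelihood is at most one, so the finite constant `C` cancels exactly.
  have hint' := ENNReal.le_of_add_le_add_right ENNReal.ofReal_ne_top
    (hint.trans (add_le_add_right hlt _))
  have hrate : ∫⁻ x, ((f x).length : ℝ≥0∞) ∂(blockLaw μ n) = n * rate μ n f := by
    rw [rate, ENNReal.mul_div_cancel hn0 hnt]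
  rw [hrate, ← distortion] at hint'
  refine (ENNReal.mul_le_mul_iff_right hn0 hnt).1 (hint'.trans_eq ?_)
  ring

theorem IsAchievable.entropy_le {μ : Measure X} [IsProbabilityMeasure μ] (hμ : entropy μ < ∞)
    {R : ℝ≥0∞} (hR : IsAchievable μ R) : entropy μ ≤ R := by
  obtain ⟨-, hRt, f, g, hf, hrate, hdist⟩ := hR
  have key : ∀ (δ : ℝ), 0 < δ → δ < 1 → ∀ M : ℕ, entropy μ ≤
      R + (ENNReal.ofReal (-Real.logb 2 (1 - δ)) + ∫⁻ x, largeInformation μ M x ∂μ) := by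
    intro δ h0 h1 M
    refine ENNReal.le_of_forall_pos_le_add fun ε hε _ => ?_
    have hε2 : (0 : ℝ≥0∞) < ε / 2 := ENNReal.half_pos (by exact_mod_cast hε.ne')
    have hd : Tendsto (fun n => (ENNReal.ofReal (-Real.logb 2 δ) + M) *
        distortion μ n (f n) (g n)) atTop (𝓝 0) := by
      simpa using ENNReal.Tendsto.const_mul hdist (Or.inr (by finiteness))
    have e1 := eventually_lt_of_limsup_lt
      (hrate.trans_lt (ENNReal.lt_add_right hRt.ne hε2.ne'))
    have e2 := hd.eventually (gt_mem_nhds hε2)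
    obtain ⟨n, h1', h2', hn⟩ := (e1.and (e2.and (eventually_gt_atTop 0))).exists
    refine (entropy_le_rate_add μ h0 h1 M hn (hf n) (g n)).trans ?_
    refine (add_le_add_left (add_le_add h1'.le h2'.le) _).trans_eq ?_
    rw [add_assoc R, ENNReal.add_halves]
    ring
  -- With `n` eliminated, `δ` and `M` are no longer coupled; `δ = 1 / (M + 2)` lies in `(0, 1)` and
  -- turns both limits into one.
  have hδ : Tendsto (fun M : ℕ => R + (ENNReal.ofReal (-Real.logb 2 (1 - 1 / ((M : ℝ) + 2))) +
      ∫⁻ x, largeInformation μ M x ∂μ)) atTop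
      (𝓝 (R + (ENNReal.ofReal (-Real.logb 2 (1 - 0)) + 0))) := by
    refine Tendsto.const_add _ (Tendsto.add ?_ (tendsto_lintegral_largeInformation μ hμ))
    refine ENNReal.tendsto_ofReal (Tendsto.neg ?_)
    have h : Tendsto (fun M : ℕ => 1 - 1 / ((M : ℝ) + 2)) atTop (𝓝 (1 - 0)) := by
      refine Tendsto.const_sub _ (Tendsto.div_atTop tendsto_const_nhds ?_)
      exact tendsto_atTop_add_const_right _ _ tendsto_natCast_atTop_atTop
    exact (h.log (by norm_num)).div_const _
  have hlim := ge_of_tendsto' hδ fun M => key (1 / ((M : ℝ) + 2)) (by positivity)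
    (by rw [div_lt_one (by positivity)]; linarith [M.cast_nonneg (α := ℝ)]) M
  simpa using hlim

end AlmostLossless

theorem mainTheorem4 {X : Type*} [Countable X] [Infinite X] [MeasurableSpace X]
    [DiscreteMeasurableSpace X] (μ : Measure X) [IsProbabilityMeasure μ]
    (hμ : AlmostLossless.entropy μ < ∞) :
    AlmostLossless.minAchievableRate μ = AlmostLossless.entropy μ ∧
      (0 < AlmostLossless.entropy μ →
        AlmostLossless.IsAchievable μ (AlmostLossless.entropy μ)) := by
  obtain ⟨f, g, hf, hrate, hdist⟩ := AlmostLossless.exists_lossless_codes μ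
  have hach : ∀ R, AlmostLossless.entropy μ ≤ R → 0 < R → R < ∞ →
      AlmostLossless.IsAchievable μ R := fun R hR h0 ht =>
    ⟨h0, ht, f, g, hf, hrate.trans hR, hdist⟩
  refine ⟨le_antisymm ?_ (le_sInf fun R hR => hR.entropy_le hμ), fun h => hach _ le_rfl h hμ⟩
  -- The slack `ε` covers zero entropy, where the entropy itself is not an admissible rate.
  refine ENNReal.le_of_forall_pos_le_add fun ε hε _ => sInf_le ?_
  have hε' : (0 : ℝ≥0∞) < ε := by exact_mod_cast hε
  exact hach _ le_self_add (hε'.trans_le le_add_self)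
    (ENNReal.add_lt_top.2 ⟨hμ, ENNReal.coe_lt_top⟩)
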